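/- Let $k\ge 2$ be an integer. For measurable $g$ on $(0,\infty)$ write $\|g\|=\sup_{x>0}|g(x)|\in[0,\infty]$; for $g=h^{(k-1)}$ below, which may exist only almost everywhere, $\|g\|$ is the essential supremum over $(0,\infty)$. For $\lambda>0$ and $m\ge 1$ let $\mathcal C_{\lambda,m}$ be the class of $h:(0,\infty)\to\mathbb R$ that are $m-1$ times differentiable, with $h^{(m-1)}$ absolutely continuous on compact subintervals of $(0,\infty)$, and for which there are $c>0$ and $a<\lambda$ with $|h^{(\ell)}(x)|\le c\,e^{ax}$ for all $x>0$ and $\ell=0,\dots,m-1$. (i) Let $r,\lambda>0$, let $q(x)=\frac{\lambda^r}{\Gamma(r)}x^{r-1}e^{-\lambda x}$ be the $\Gamma(r,\lambda)$ density, and let $\Gamma_{r,\lambda}h=\mathbb E\,h(X)$ for $X\sim\Gamma(r,\lambda)$. Let $h\in\mathcal C_{\lambda,k-1}$ with $h^{(k-2)}$ bounded ($h^{(0)}=h$), and let $f:(0,\infty)\to\mathbb R$ be a function (determined up to an additive constant) with $$f'(x)=\frac{1}{x\,q(x)}\int_0^x\big(h(t)-\Gamma_{r,\lambda}h\big)q(t)\,dt,\qquad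 x>0.$$ Then $f$ is $k$ times continuously differentiable on $(0,\infty)$, it solves the Stein equation $xf''(x)+(r-\lambda x)f'(x)=h(x)-\Gamma_{r,\lambda}h$ for $x>0$, and $$\|f^{(k)}\|\le\frac{2}{r+k-1}\big(3\|h^{(k-1)}\|+2\lambda\|h^{(k-2)}\|\big).$$ (ii) Let $p>0$, let $q(x)=\frac{x^{p/2-1}e^{-x/2}}{2^{p/2}\Gamma(p/2)}$ be the $\chi^2_{(p)}$ density, and let $\chi^2_{(p)}h=\mathbb E\,h(X)$ for $X\sim\chi^2_{(p)}$. Let $h\in\mathcal C_{1/2,k-1}$ with $h^{(k-2)}$ bounded, and let $f:(0,\infty)\to\mathbb R$ have the derivative displayed in (i), with this $q$ and with $\chi^2_{(p)}h$ in place of $\Gamma_{r,\lambda}h$. Then $f$ is $k$ times continuously differentiable on $(0,\infty)$, it solves $xf''(x)+\frac12(p-x)f'(x)=h(x)-\chi^2_{(p)}h$ for $x>0$, and $$\|f^{(k)}\|\le\frac{4}{p+2}\big(3\|h^{(k-1)}\|+\|h^{(k-2)}\|\big).$$ -/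

import Mathlib

open Set MeasureTheory ProbabilityTheory
open scoped ENNReal

noncomputable section

/-- The supremum norm `sup_{x > 0} |g x|` over the positive half-line, as an extended
nonnegative real (`∞` if `g` is unbounded on `(0, ∞)`). -/
def supNormPos (g : ℝ → ℝ) : ℝ≥0∞ :=
  ⨆ x ∈ Ioi (0 : ℝ), ‖g x‖ₑ

/-- The essential supremum of `|g|` over the positive half-line. It is used for derivatives of
(locally) absolutely continuous functions, which exist only almost everywhere. -/
def essSupNormPos (g : ℝ → ℝ) : ℝ≥0∞ :=
  essSup (fun x => ‖g x‖ₑ) (volume.restrict (Ioi (0 : ℝ)))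

/-- The class `C_{lam, m}` (`m ≥ 1`) of test functions on `(0, ∞)`: functions `h` such that
`h, h', …, h^{(m-1)}` exist, satisfy `|h^{(l)}(x)| ≤ c e^{a x}` for all `x > 0`, with some constants
`c > 0` and `a < lam`, and `h^{(m-1)}` is absolutely continuous on every compact subinterval of
`(0, ∞)`. Only the values of `h` on `(0, ∞)` matter. -/
def testClass (lam : ℝ) (m : ℕ) : Set (ℝ → ℝ) :=
  {h | ContDiffOn ℝ (m - 1 : ℕ) h (Ioi 0) ∧
    (∃ c > (0 : ℝ), ∃ a < lam, ∀ x > (0 : ℝ), ∀ l < m,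
      |iteratedDeriv l h x| ≤ c * Real.exp (a * x)) ∧
    ∀ u v : ℝ, 0 < u → u ≤ v → AbsolutelyContinuousOnInterval (iteratedDeriv (m - 1) h) u v}

/-- For a density `q` on `(0, ∞)` and a number `m` (the mean of `h` under `q`), the function
`x ↦ (1 / (x q(x))) ∫_0^x (h(t) - m) q(t) dt`. -/
def steinDeriv (q : ℝ → ℝ) (m : ℝ) (h : ℝ → ℝ) (x : ℝ) : ℝ :=
  1 / (x * q x) * ∫ t in (0 : ℝ)..x, (h t - m) * q t

/-- `E h(X)` for `X` with the gamma distribution of shape `r` and rate `lam`. -/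
def gammaMean (r lam : ℝ) (h : ℝ → ℝ) : ℝ :=
  ∫ x, h x ∂(gammaMeasure r lam)

/-- `f` is the solution (unique up to an additive constant) of the `Γ(r, lam)` Stein equation: on
`(0, ∞)` its derivative is `f'(x) = (1 / (x q(x))) ∫_0^x (h(t) - E h(X)) q(t) dt`, where `q` is the
`Γ(r, lam)` density and `X` has that distribution. -/
def IsGammaSteinSolution (r lam : ℝ) (h f : ℝ → ℝ) : Prop :=
  ∀ x > (0 : ℝ), HasDerivAt f (steinDeriv (gammaPDFReal r lam) (gammaMean r lam h) h x) x

/-- The density of the chi-square distribution with `p` degrees of freedom. -/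
def chiSquarePDF (p x : ℝ) : ℝ :=
  if 0 < x then x ^ (p / 2 - 1) * Real.exp (-x / 2) / (2 ^ (p / 2) * Real.Gamma (p / 2)) else 0

/-- The chi-square distribution with `p` degrees of freedom. -/
def chiSquareMeasure (p : ℝ) : Measure ℝ :=
  volume.withDensity fun x => ENNReal.ofReal (chiSquarePDF p x)

/-- `E h(X)` for `X` with the chi-square distribution with `p` degrees of freedom. -/
def chiSquareMean (p : ℝ) (h : ℝ → ℝ) : ℝ :=
  ∫ x, h x ∂(chiSquareMeasure p)

/-- `f` is the solution (unique up to an additive constant) of the chi-square Stein equation with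
`p` degrees of freedom. -/
def IsChiSquareSteinSolution (p : ℝ) (h f : ℝ → ℝ) : Prop :=
  ∀ x > (0 : ℝ), HasDerivAt f (steinDeriv (chiSquarePDF p) (chiSquareMean p h) h x) x

end

/-! Write W_s(x) = x^s e^(-lam x), g = h - E h(X) and k = n + 2. Differentiating the Stein equation
j times gives x f^(j+2) + (r + j - lam x) f^(j+1) = g^(j) + lam j f^(j). In divergence form this
says that N_j = W_(r+j) f^(j+1) has derivative W_(r+j-1) φ_j, with φ_j = g^(j) + lam j f^(j). Each
N_j vanishes at 0 and at ∞: for j = 0 because g has mean zero, and for larger j by the recursion and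
the growth bounds on h.

Two facts about such equations are used for j = n and j = n + 1. The maximum principle
(`mul_abs_le_of_maximum_principle`) gives lam j |f^(j)| ≤ sup |g^(j)|, so that |φ_j| ≤ 2 sup
|g^(j)|. Comparison with W_s (`abs_mul_abs_le_gammaWeight`) then turns |φ_j| ≤ G into |r + j - lam
x| |f^(j+1)| ≤ G.

For j = n this bounds both terms of x f^(n+2) = φ_n - (r + n - lam x) f^(n+1). For j = n + 1 it
bounds |r + n + 1 - lam x| |f^(n+2)|. Adding lam x |f^(n+2)| to the latter removes the factor that
vanishes inside the half-line and leaves r + n + 1 (`gammaStein_bound`). At the level j = n + 1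
derivatives exist only almost everywhere, so the arguments run on absolutely continuous functions.
-/

section GammaStein

open Filter Topology

/-! ### The gamma weight: derivative and limits at the ends. -/

/-- The unnormalised gamma weight `x ^ s * exp (-lam x)`. -/
noncomputable def gammaWeight (lam s x : ℝ) : ℝ :=
  x ^ s * Real.exp (-(lam * x))

theorem gammaWeight_pos (lam s : ℝ) {x : ℝ} (hx : 0 < x) : 0 < gammaWeight lam s x := by
  unfold gammaWeight; positivity

theorem gammaWeight_add_one (lam s : ℝ) {x : ℝ} (hx : 0 < x) :
    gammaWeight lam (s + 1) x = x * gammaWeight lam s x := by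
  unfold gammaWeight
  rw [Real.rpow_add_one hx.ne']
  ring

theorem hasDerivAt_gammaWeight (lam s : ℝ) {x : ℝ} (hx : 0 < x) :
    HasDerivAt (gammaWeight lam s) ((s - lam * x) * gammaWeight lam (s - 1) x) x := by
  have h1 := Real.hasDerivAt_rpow_const (x := x) (p := s) (Or.inl hx.ne')
  have h2 : HasDerivAt (fun x : ℝ => Real.exp (-(lam * x))) (Real.exp (-(lam * x)) * (-lam)) x := by
    simpa using (((hasDerivAt_id x).const_mul lam).neg).exp
  have h3 := h1.mul h2
  refine h3.congr_deriv ?_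
  have : x ^ s = x * x ^ (s - 1) := by
    rw [mul_comm, ← Real.rpow_add_one hx.ne']; simp
  unfold gammaWeight
  rw [this]
  ring

theorem contDiffOn_gammaWeight (lam s : ℝ) (n : WithTop ℕ∞) :
    ContDiffOn ℝ n (gammaWeight lam s) (Ioi 0) := by
  unfold gammaWeight
  refine ContDiffOn.mul (fun x hx => ?_) (by fun_prop)
  exact (Real.contDiffAt_rpow_const_of_ne (ne_of_gt hx)).contDiffWithinAt

theorem tendsto_gammaWeight_atTop {lam : ℝ} (hlam : 0 < lam) (s : ℝ) :
    Tendsto (gammaWeight lam s) atTop (𝓝 0) := by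
  simpa [gammaWeight, Function.comp_def] using!
    tendsto_rpow_mul_exp_neg_mul_atTop_nhds_zero s lam hlam

theorem tendsto_gammaWeight_zero (lam : ℝ) {s : ℝ} (hs : 0 < s) :
    Tendsto (gammaWeight lam s) (𝓝[>] 0) (𝓝 0) := by
  have : ContinuousAt (gammaWeight lam s) 0 := by
    unfold gammaWeight
    exact (Real.continuousAt_rpow_const _ _ (Or.inr hs.le)).mul (by fun_prop)
  have h := this.tendsto
  simp only [gammaWeight, Real.zero_rpow hs.ne', zero_mul] at h
  exact h.mono_left nhdsWithin_le_nhds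

/-! ### Comparison with the gamma weight. -/

theorem AbsolutelyContinuousOnInterval.le_of_deriv_nonneg {F : ℝ → ℝ} {a b : ℝ} (hab : a ≤ b)
    (hF : AbsolutelyContinuousOnInterval F a b) (hd : ∀ᵐ x, x ∈ Icc a b → 0 ≤ deriv F x) :
    F a ≤ F b := by
  have h : 0 ≤ ∫ x in a..b, deriv F x :=
    intervalIntegral.integral_nonneg_of_ae_restrict hab
      ((ae_restrict_iff' measurableSet_Icc).2 hd)
  rw [hF.integral_deriv_eq_sub] at h
  linarith

/-- If `N' = x ^ (s - 1) * exp (-lam x) * φ` almost everywhere with `|φ| ≤ G`, and `N` vanishes at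
`0` and at `∞`, then `|s - lam x| * |N x| ≤ G * x ^ s * exp (-lam x)`. -/
theorem abs_mul_abs_le_gammaWeight {lam s G : ℝ} {N φ : ℝ → ℝ} (hlam : 0 < lam) (hs : 0 < s)
    (hG : 0 ≤ G)
    (hAC : ∀ u v : ℝ, 0 < u → u ≤ v → AbsolutelyContinuousOnInterval N u v)
    (hd : ∀ᵐ x, 0 < x → HasDerivAt N (gammaWeight lam (s - 1) x * φ x) x)
    (hφ : ∀ᵐ x, 0 < x → |φ x| ≤ G)
    (h0 : Tendsto N (𝓝[>] 0) (𝓝 0)) (htop : Tendsto N atTop (𝓝 0)) {x : ℝ} (hx : 0 < x) :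
    |s - lam * x| * |N x| ≤ G * gammaWeight lam s x := by
  -- The factor s - lam x is frozen at the endpoint x, with either sign. Then F' = W_(s-1) (G (s -
  -- lam t) - e φ(t)) has a constant sign on the side of x away from s / lam, where F tends to 0.
  have key : ∀ e : ℝ, |e| = |s - lam * x| → e * N x ≤ G * gammaWeight lam s x := by
    intro e he
    set F : ℝ → ℝ := fun t => G * gammaWeight lam s t - e * N t with hFdef
    have hFAC : ∀ u v : ℝ, 0 < u → u ≤ v → AbsolutelyContinuousOnInterval F u v := by
      intro u v hu huv
      have hW : AbsolutelyContinuousOnInterval (gammaWeight lam s) u v :=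
        ((contDiffOn_gammaWeight lam s 1).mono (by
          rw [uIcc_of_le huv]; exact fun t ht => hu.trans_le ht.1)).absolutelyContinuousOnInterval
      exact (hW.const_mul G).sub ((hAC u v hu huv).const_mul e)
    have hFd : ∀ᵐ t, 0 < t → deriv F t =
        gammaWeight lam (s - 1) t * (G * (s - lam * t) - e * φ t) := by
      filter_upwards [hd] with t ht htp
      have := ((hasDerivAt_gammaWeight lam s htp).const_mul G).sub ((ht htp).const_mul e)
      refine (HasDerivAt.deriv this).trans ?_
      ring
    have hφe : ∀ᵐ t, 0 < t → |e * φ t| ≤ G * |s - lam * x| := by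
      filter_upwards [hφ] with t ht htp
      rw [abs_mul, he, mul_comm]
      exact mul_le_mul_of_nonneg_right (ht htp) (abs_nonneg _)
    suffices 0 ≤ F x by simp only [hFdef] at this; linarith
    rcases lt_or_ge (lam * x) s with hlt | hge
    · rw [abs_of_pos (sub_pos.2 hlt)] at hφe
      have hmono : ∀ u, 0 < u → u ≤ x → F u ≤ F x := by
        intro u hu hux
        refine (hFAC u x hu hux).le_of_deriv_nonneg hux ?_
        filter_upwards [hFd, hφe] with t h1 h2 ht
        have htp := hu.trans_le ht.1
        rw [h1 htp]
        refine mul_nonneg (gammaWeight_pos _ _ htp).le ?_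
        have h3 := (abs_le.1 (h2 htp)).2
        have h4 : G * (s - lam * x) ≤ G * (s - lam * t) := by
          gcongr; exact ht.2
        linarith
      have hlim : Tendsto F (𝓝[>] 0) (𝓝 0) := by
        simpa using ((tendsto_gammaWeight_zero lam hs).const_mul G).sub (h0.const_mul e)
      refine le_of_tendsto hlim ?_
      filter_upwards [Ioc_mem_nhdsGT hx] with u hu using hmono u hu.1 hu.2
    · rw [abs_of_nonpos (sub_nonpos.2 hge)] at hφe
      have hmono : ∀ u, x ≤ u → F u ≤ F x := by
        intro u hxu
        have := ((hFAC x u hx hxu).neg).le_of_deriv_nonneg hxu ?_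
        · simpa using this
        filter_upwards [hFd, hφe] with t h1 h2 ht
        have htp := hx.trans_le ht.1
        rw [deriv.neg, h1 htp, ← mul_neg]
        refine mul_nonneg (gammaWeight_pos _ _ htp).le ?_
        have h3 := (abs_le.1 (h2 htp)).1
        have h4 : G * (s - lam * t) ≤ G * (s - lam * x) := by
          gcongr; exact ht.1
        linarith
      have hlim : Tendsto F atTop (𝓝 0) := by
        simpa using ((tendsto_gammaWeight_atTop hlam s).const_mul G).sub (htop.const_mul e)
      refine le_of_tendsto hlim ?_
      filter_upwards [eventually_ge_atTop x] with u hu using hmono u hu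
  rw [← abs_mul]
  rcases abs_choice ((s - lam * x) * N x) with h | h
  · rw [h]; exact key _ rfl
  · rw [h, ← neg_mul]; exact key _ (abs_neg _)

/-! ### The maximum principle. -/

theorem exists_mem_of_ae_of_lt {P : ℝ → Prop} {a b : ℝ} (hab : a < b) (h : ∀ᵐ x, P x) :
    ∃ x ∈ Ioo a b, P x := by
  obtain ⟨x, hx, hxP⟩ := ((Measure.dense_of_ae h).inter_open_nonempty _ isOpen_Ioo
    (nonempty_Ioo.2 hab))
  exact ⟨x, hx, hxP⟩

/-- A one-sided maximum principle for `(p v')' = w (ψ + κ v)` on `(0, ∞)`, where `N = p v'`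
vanishes at both ends. -/
theorem mul_le_of_maximum_principle {κ H : ℝ} {v v' p w N ψ : ℝ → ℝ} (hκ : 0 < κ)
    (hp : ∀ x > 0, 0 < p x) (hw : ∀ x > 0, 0 < w x)
    (hv : ∀ x > 0, HasDerivAt v (v' x) x) (hN : ∀ x > 0, N x = p x * v' x)
    (hAC : ∀ a b : ℝ, 0 < a → a ≤ b → AbsolutelyContinuousOnInterval N a b)
    (hd : ∀ᵐ x, 0 < x → HasDerivAt N (w x * (ψ x + κ * v x)) x)
    (hψ : ∀ᵐ x, 0 < x → -H ≤ ψ x)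
    (h0 : Tendsto N (𝓝[>] 0) (𝓝 0)) (htop : Tendsto N atTop (𝓝 0)) {x : ℝ} (hx : 0 < x) :
    κ * v x ≤ H := by
  -- Wherever κ v > H, N is nondecreasing. Move away from x in the direction in which v does not
  -- decrease, given by the sign of N x: v stays above v x and N keeps its sign while moving away
  -- from 0, yet it must tend to 0. Hence N vanishes on a whole interval.
  by_contra! hcon
  have hvc : ContinuousOn v (Ioi 0) := fun t ht => (hv t ht).continuousAt.continuousWithinAt
  have hNc : ContinuousOn N (Ioi 0) := by
    intro t ht
    have ht' : 0 < t := ht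
    have h1 : ContinuousOn N (uIcc (t / 2) (t + 1)) :=
      (hAC (t / 2) (t + 1) (by linarith) (by linarith)).continuousOn
    rw [uIcc_of_le (by linarith)] at h1
    exact (h1.continuousAt (Icc_mem_nhds (by linarith) (by linarith))).continuousWithinAt
  have hNmono : ∀ a b, 0 < a → a ≤ b → (∀ t ∈ Icc a b, H ≤ κ * v t) → N a ≤ N b := by
    intro a b ha hab hab'
    refine (hAC a b ha hab).le_of_deriv_nonneg hab ?_
    filter_upwards [hd, hψ] with t h1 h2 ht
    have htp := ha.trans_le ht.1
    rw [(h1 htp).deriv]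
    exact mul_nonneg (hw t htp).le (by linarith [h2 htp, hab' t ht])
  have hvmono : ∀ a b, 0 < a → a ≤ b → (∀ t ∈ Icc a b, 0 ≤ N t) → v a ≤ v b := by
    intro a b ha hab hab'
    have hsub : Icc a b ⊆ Ioi 0 := fun t ht => ha.trans_le ht.1
    refine monotoneOn_of_deriv_nonneg (convex_Icc a b) (hvc.mono hsub) ?_ ?_
      (left_mem_Icc.2 hab) (right_mem_Icc.2 hab) hab
    · exact fun t ht => (hv t (hsub (interior_subset ht))).differentiableAt.differentiableWithinAt
    · intro t ht
      have ht' := interior_subset ht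
      rw [(hv t (hsub ht')).deriv]
      have := hab' t ht'
      rw [hN t (hsub ht')] at this
      exact nonneg_of_mul_nonneg_right this (hp t (hsub ht'))
  have hvanti : ∀ a b, 0 < a → a ≤ b → (∀ t ∈ Icc a b, N t ≤ 0) → v b ≤ v a := by
    intro a b ha hab hab'
    have hsub : Icc a b ⊆ Ioi 0 := fun t ht => ha.trans_le ht.1
    refine antitoneOn_of_deriv_nonpos (convex_Icc a b) (hvc.mono hsub) ?_ ?_
      (left_mem_Icc.2 hab) (right_mem_Icc.2 hab) hab
    · exact fun t ht => (hv t (hsub (interior_subset ht))).differentiableAt.differentiableWithinAt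
    · intro t ht
      have ht' := interior_subset ht
      rw [(hv t (hsub ht')).deriv]
      have := hab' t ht'
      rw [hN t (hsub ht')] at this
      exact nonpos_of_mul_nonpos_right this (hp t (hsub ht'))
  -- On such an interval N' = 0, while w (ψ + κ v) > 0 almost everywhere.
  have hzero : ∀ a b, 0 < a → a < b → (∀ t ∈ Icc a b, v x ≤ v t ∧ N t = 0) → False := by
    intro a b ha hab h
    obtain ⟨t, ht, h1, h2⟩ := exists_mem_of_ae_of_lt hab (hd.and hψ)
    have htp := ha.trans ht.1
    have h3 : N =ᶠ[𝓝 t] fun _ => 0 := by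
      filter_upwards [Icc_mem_nhds ht.1 ht.2] with y hy using (h y hy).2
    have h4 : w t * (ψ t + κ * v t) = 0 :=
      (h1 htp).unique ((hasDerivAt_const t (0 : ℝ)).congr_of_eventuallyEq h3)
    have h5 : κ * v x ≤ κ * v t := by
      gcongr; exact (h t (Ioo_subset_Icc_self ht)).1
    have := mul_pos (hw t htp) (show 0 < ψ t + κ * v t by linarith [h2 htp])
    exact this.ne' h4
  rcases le_total 0 (N x) with hNx | hNx
  -- Continuous induction: the condition is closed, and it extends to the right because H < κ v
  -- persists near t.
  · have hS : ∀ b, x ≤ b → Icc x b ⊆ {t | v x ≤ v t ∧ 0 ≤ N t} := by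
      intro b hb
      have hsub : Icc x b ⊆ Ioi 0 := fun t ht => hx.trans_le ht.1
      refine IsClosed.Icc_subset_of_forall_exists_gt ?_ ⟨le_rfl, hNx⟩ ?_
      · have h1 := (hvc.mono hsub).preimage_isClosed_of_isClosed isClosed_Icc
          (isClosed_Ici (a := v x))
        have h2 := (hNc.mono hsub).preimage_isClosed_of_isClosed isClosed_Icc
          (isClosed_Ici (a := (0 : ℝ)))
        convert h1.inter h2 using 1
        ext t
        simp only [mem_inter_iff, mem_ofPred_eq, mem_preimage, mem_Ici]
        tauto
      · rintro t ⟨⟨ht1, ht2⟩, ht3⟩ y hy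
        have htp : 0 < t := hx.trans_le ht3.1
        have hev : ∀ᶠ z in 𝓝 t, H < κ * v z := by
          refine ((hv t htp).continuousAt.const_mul κ).eventually (lt_mem_nhds ?_)
          exact hcon.trans_le (mul_le_mul_of_nonneg_left ht1 hκ.le)
        obtain ⟨δ, hδ, hball⟩ := Metric.eventually_nhds_iff.1 hev
        have hz1 : t < min y (t + δ / 2) := lt_min hy (by linarith)
        have hz2 : min y (t + δ / 2) ≤ t + δ / 2 := min_le_right _ _
        have hNz : ∀ z ∈ Icc t (min y (t + δ / 2)), 0 ≤ N z := by
          intro z hz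
          refine ht2.trans (hNmono t z htp hz.1 fun q hq => (hball ?_).le)
          rw [Real.dist_eq, abs_of_nonneg (by linarith [hq.1])]
          linarith [hq.2, hz.2]
        exact ⟨min y (t + δ / 2), ⟨ht1.trans (hvmono _ _ htp hz1.le hNz),
          hNz _ (right_mem_Icc.2 hz1.le)⟩, hz1, min_le_left _ _⟩
    have hge : ∀ t, x ≤ t → v x ≤ v t ∧ 0 ≤ N t := fun t ht => hS t ht ⟨ht, le_rfl⟩
    have hle : ∀ t, x ≤ t → N t ≤ 0 := by
      intro t ht
      refine ge_of_tendsto htop ?_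
      filter_upwards [eventually_ge_atTop t] with y hy
      refine hNmono t y (hx.trans_le ht) hy fun q hq => hcon.le.trans ?_
      gcongr
      exact (hge q (ht.trans hq.1)).1
    exact hzero x (x + 1) hx (by linarith) fun t ht =>
      ⟨(hge t ht.1).1, le_antisymm (hle t ht.1) (hge t ht.1).2⟩
  · have hS : ∀ b, 0 < b → b ≤ x → Icc b x ⊆ {t | v x ≤ v t ∧ N t ≤ 0} := by
      intro b hb0 hb
      have hsub : Icc b x ⊆ Ioi 0 := fun t ht => hb0.trans_le ht.1
      refine IsClosed.Icc_subset_of_forall_exists_lt ?_ ⟨le_rfl, hNx⟩ ?_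
      · have h1 := (hvc.mono hsub).preimage_isClosed_of_isClosed isClosed_Icc
          (isClosed_Ici (a := v x))
        have h2 := (hNc.mono hsub).preimage_isClosed_of_isClosed isClosed_Icc
          (isClosed_Iic (a := (0 : ℝ)))
        convert h1.inter h2 using 1
        ext t
        simp only [mem_inter_iff, mem_ofPred_eq, mem_preimage, mem_Ici, mem_Iic]
        tauto
      · rintro t ⟨⟨ht1, ht2⟩, ht3⟩ y hy
        have htp : 0 < t := hb0.trans ht3.1
        have hev : ∀ᶠ z in 𝓝 t, H < κ * v z := by
          refine ((hv t htp).continuousAt.const_mul κ).eventually (lt_mem_nhds ?_)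
          exact hcon.trans_le (mul_le_mul_of_nonneg_left ht1 hκ.le)
        obtain ⟨δ, hδ, hball⟩ := Metric.eventually_nhds_iff.1 hev
        -- The three terms keep m at or above y, positive, and within δ of t.
        set m := max (max y (t / 2)) (t - δ / 2) with hm
        have hz1 : m < t := max_lt (max_lt hy (by linarith)) (by linarith)
        have hz2 : t - δ / 2 ≤ m := le_max_right _ _
        have hm0 : 0 < m := lt_of_lt_of_le (by linarith) ((le_max_right y (t / 2)).trans
          (le_max_left _ _))
        have hNz : ∀ z ∈ Icc m t, N z ≤ 0 := by
          intro z hz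
          refine (hNmono z t (hm0.trans_le hz.1) hz.2 fun q hq => (hball ?_).le).trans ht2
          rw [Real.dist_eq, abs_of_nonpos (by linarith [hq.2])]
          linarith [hq.1, hz.1]
        exact ⟨m, ⟨ht1.trans (hvanti _ _ hm0 hz1.le hNz),
          hNz _ (left_mem_Icc.2 hz1.le)⟩, (le_max_left _ _).trans (le_max_left _ _), hz1⟩
    have hge : ∀ t, 0 < t → t ≤ x → v x ≤ v t ∧ N t ≤ 0 :=
      fun t ht0 ht => hS t ht0 ht ⟨le_rfl, ht⟩
    have hle : ∀ t, 0 < t → t ≤ x → 0 ≤ N t := by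
      intro t ht0 ht
      refine le_of_tendsto h0 ?_
      filter_upwards [Ioc_mem_nhdsGT ht0] with y hy
      refine hNmono y t hy.1 hy.2 fun q hq => hcon.le.trans ?_
      gcongr
      exact (hge q (hy.1.trans_le hq.1) (hq.2.trans ht)).1
    exact hzero (x / 2) x (by linarith) (by linarith) fun t ht =>
      have ht0 : 0 < t := by linarith [ht.1]
      ⟨(hge t ht0 ht.2).1, le_antisymm (hge t ht0 ht.2).2 (hle t ht0 ht.2)⟩

/-- The equation is linear, so the one-sided bound applies to v and to -v. -/
theorem mul_abs_le_of_maximum_principle {κ H : ℝ} {v v' p w N ψ : ℝ → ℝ} (hκ : 0 < κ)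
    (hp : ∀ x > 0, 0 < p x) (hw : ∀ x > 0, 0 < w x)
    (hv : ∀ x > 0, HasDerivAt v (v' x) x) (hN : ∀ x > 0, N x = p x * v' x)
    (hAC : ∀ a b : ℝ, 0 < a → a ≤ b → AbsolutelyContinuousOnInterval N a b)
    (hd : ∀ᵐ x, 0 < x → HasDerivAt N (w x * (ψ x + κ * v x)) x)
    (hψ : ∀ᵐ x, 0 < x → |ψ x| ≤ H)
    (h0 : Tendsto N (𝓝[>] 0) (𝓝 0)) (htop : Tendsto N atTop (𝓝 0)) {x : ℝ} (hx : 0 < x) :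
    κ * |v x| ≤ H := by
  have h1 := mul_le_of_maximum_principle hκ hp hw hv hN hAC hd
    (hψ.mono fun t ht htp => (abs_le.1 (ht htp)).1) h0 htop hx
  have h2 := mul_le_of_maximum_principle (v := -v) (v' := -v') (N := -N) (ψ := -ψ) hκ hp hw
    (fun t ht => (hv t ht).neg) (fun t ht => by simp [hN t ht])
    (fun a b ha hab => (hAC a b ha hab).neg)
    (hd.mono fun t ht htp => (ht htp).neg.congr_deriv (by simp only [Pi.neg_apply]; ring))
    (hψ.mono fun t ht htp => neg_le_neg (abs_le.1 (ht htp)).2)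
    (by simpa using! h0.neg) (by simpa using! htop.neg) hx
  rcases abs_choice (v x) with h | h <;> rw [h]
  · exact h1
  · exact h2

/-! ### Regularity, the differentiated Stein equation, and boundary behaviour. -/

theorem ContDiffOn.hasDerivAt_iteratedDeriv {f : ℝ → ℝ} {n : WithTop ℕ∞} {m : ℕ}
    (hf : ContDiffOn ℝ n f (Ioi 0)) (hm : m < n) {x : ℝ} (hx : 0 < x) :
    HasDerivAt (iteratedDeriv m f) (iteratedDeriv (m + 1) f x) x := by
  have h := (hf.differentiableOn_iteratedDerivWithin hm (uniqueDiffOn_Ioi 0)).congr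
    (fun y hy => (iteratedDerivWithin_of_isOpen isOpen_Ioi hy).symm)
  rw [iteratedDeriv_succ]
  exact (h.differentiableAt (Ioi_mem_nhds hx)).hasDerivAt

theorem ContDiffOn.continuousOn_iteratedDeriv {f : ℝ → ℝ} {n : WithTop ℕ∞} {m : ℕ}
    (hf : ContDiffOn ℝ n f (Ioi 0)) (hm : m ≤ n) : ContinuousOn (iteratedDeriv m f) (Ioi 0) :=
  (hf.continuousOn_iteratedDerivWithin hm (uniqueDiffOn_Ioi 0)).congr
    (fun _ hy => (iteratedDerivWithin_of_isOpen isOpen_Ioi hy).symm)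

theorem absolutelyContinuousOnInterval_of_hasDerivAt {f f' : ℝ → ℝ}
    (hf : ∀ x > 0, HasDerivAt f (f' x) x) (hf' : ContinuousOn f' (Ioi 0)) {u v : ℝ}
    (hu : 0 < u) (huv : u ≤ v) : AbsolutelyContinuousOnInterval f u v := by
  have h : ContDiffOn ℝ ((0 : WithTop ℕ∞) + 1) f (Ioi 0) := by
    rw [contDiffOn_succ_iff_deriv_of_isOpen isOpen_Ioi]
    refine ⟨fun x hx => (hf x hx).differentiableAt.differentiableWithinAt, by simp, ?_⟩
    rw [contDiffOn_zero]
    exact hf'.congr fun x hx => (hf x hx).deriv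
  rw [zero_add] at h
  refine (h.mono ?_).absolutelyContinuousOnInterval
  rw [uIcc_of_le huv]
  exact fun t ht => hu.trans_le ht.1

/-- Regularity of the solutions of the gamma Stein equation. -/
theorem contDiffOn_of_gammaStein_eq {n : ℕ} {r lam : ℝ} {f g : ℝ → ℝ}
    (hg : ContDiffOn ℝ n g (Ioi 0)) (hf : ∀ x > 0, DifferentiableAt ℝ f x)
    (hf' : ∀ x > 0, HasDerivAt (deriv f) ((g x - (r - lam * x) * deriv f x) / x) x) :
    ContDiffOn ℝ (n + 2 : ℕ) f (Ioi 0) := by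
  have h : ∀ m : ℕ, m ≤ n + 1 → ContDiffOn ℝ m (deriv f) (Ioi 0) := by
    intro m
    induction m with
    | zero =>
      intro _
      rw [Nat.cast_zero, contDiffOn_zero]
      exact fun x hx => (hf' x hx).continuousAt.continuousWithinAt
    | succ m ih =>
      intro hm
      rw [Nat.cast_succ, contDiffOn_succ_iff_deriv_of_isOpen isOpen_Ioi]
      refine ⟨fun x hx => (hf' x hx).differentiableAt.differentiableWithinAt, by simp, ?_⟩
      have hgm : ContDiffOn ℝ m g (Ioi 0) := hg.of_le (by exact_mod_cast Nat.le_of_succ_le_succ hm)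
      have hfm := ih (by omega)
      have hlin : ContDiffOn ℝ m (fun x : ℝ => r - lam * x) (Ioi 0) := by fun_prop
      refine ((hgm.sub (hlin.mul hfm)).div contDiffOn_id fun x hx => ne_of_gt hx).congr ?_
      exact fun x hx => (hf' x hx).deriv
  have h2 := h (n + 1) le_rfl
  rw [show n + 2 = (n + 1) + 1 from rfl, Nat.cast_succ,
    contDiffOn_succ_iff_deriv_of_isOpen isOpen_Ioi]
  exact ⟨fun x hx => (hf x hx).differentiableWithinAt, by simp, h2⟩

/-- The Stein equation differentiated `j` times. -/
theorem iteratedDeriv_gammaStein_eq {n : ℕ} {r lam : ℝ} {f g : ℝ → ℝ}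
    (hg : ContDiffOn ℝ n g (Ioi 0)) (hf : ContDiffOn ℝ (n + 2 : ℕ) f (Ioi 0))
    (heq : ∀ x > 0, x * iteratedDeriv 2 f x + (r - lam * x) * iteratedDeriv 1 f x = g x) {j : ℕ}
    (hj : j ≤ n) {x : ℝ} (hx : 0 < x) :
    x * iteratedDeriv (j + 2) f x + (r + j - lam * x) * iteratedDeriv (j + 1) f x =
      iteratedDeriv j g x + lam * (j * iteratedDeriv j f x) := by
  induction j generalizing x with
  | zero => simpa using heq x hx
  | succ j ih =>
    have hD : ∀ m < n + 2, HasDerivAt (iteratedDeriv m f) (iteratedDeriv (m + 1) f x) x :=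
      fun m hm => hf.hasDerivAt_iteratedDeriv (by exact_mod_cast hm) hx
    have hgD := hg.hasDerivAt_iteratedDeriv (m := j) (by exact_mod_cast hj) hx
    have hL := ((hasDerivAt_id x).mul (hD (j + 2) (by omega))).add
      ((((hasDerivAt_id x).const_mul lam).const_sub (r + j)).mul (hD (j + 1) (by omega)))
    have hR := hgD.add (((hD j (by omega)).const_mul (j : ℝ)).const_mul lam)
    have := hL.unique (hR.congr_of_eventuallyEq (by
      filter_upwards [Ioi_mem_nhds hx] with y hy using ih (by omega) hy))
    simp only [id] at this
    push_cast
    linarith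

/-- Derivatives of solutions of the Stein equation inherit from the right-hand side the decay
at `∞` against every gamma weight. -/
theorem tendsto_gammaWeight_mul_iteratedDeriv_atTop {n : ℕ} {r lam : ℝ} {f g : ℝ → ℝ}
    (hrec : ∀ j ≤ n, ∀ x > 0, x * iteratedDeriv (j + 2) f x +
      (r + j - lam * x) * iteratedDeriv (j + 1) f x =
      iteratedDeriv j g x + lam * (j * iteratedDeriv j f x))
    (hg : ∀ j ≤ n, ∀ s, Tendsto (fun x => gammaWeight lam s x * iteratedDeriv j g x) atTop (𝓝 0))
    (hf : ∀ s, Tendsto (fun x => gammaWeight lam s x * iteratedDeriv 1 f x) atTop (𝓝 0)) {j : ℕ}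
    (hj : j ≤ n + 1) (s : ℝ) :
    Tendsto (fun x => gammaWeight lam s x * (j * iteratedDeriv j f x)) atTop (𝓝 0) ∧
    Tendsto (fun x => gammaWeight lam s x * iteratedDeriv (j + 1) f x) atTop (𝓝 0) := by
  -- The factor j in the first limit makes it trivial at j = 0, so nothing is required of f itself,
  -- which is only known up to a constant. The exponent s varies because solving for f^(j+2) uses
  -- the weights s - 1 and s.
  induction j generalizing s with
  | zero => exact ⟨by simp, hf s⟩
  | succ j ih =>
    have ih := ih (by omega)
    constructor
    · refine Tendsto.congr (fun x => ?_) (by simpa using ((ih s).2.const_mul ((j : ℝ) + 1)))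
      push_cast
      ring
    · have h1 := ((hg j (by omega) (s - 1)).add ((ih (s - 1)).1.const_mul lam)).sub
        (((ih (s - 1)).2.const_mul (r + j)).sub ((ih s).2.const_mul lam))
      simp only [mul_zero, add_zero, sub_zero] at h1
      refine h1.congr' ?_
      filter_upwards [eventually_gt_atTop 0] with x hx
      have hw := gammaWeight_add_one lam (s - 1) hx
      rw [sub_add_cancel] at hw
      have := hrec j (by omega) x hx
      rw [hw]
      linear_combination (-gammaWeight lam (s - 1) x) * this

/-- Behaviour at `0` of the derivatives of solutions of the Stein equation. -/
theorem tendsto_gammaWeight_mul_iteratedDeriv_zero {n : ℕ} {r lam : ℝ} {f g : ℝ → ℝ}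
    (hrec : ∀ j ≤ n, ∀ x > 0, x * iteratedDeriv (j + 2) f x +
      (r + j - lam * x) * iteratedDeriv (j + 1) f x =
      iteratedDeriv j g x + lam * (j * iteratedDeriv j f x))
    (hg : ∀ j ≤ n, Tendsto (fun x => gammaWeight lam (r + j) x * iteratedDeriv j g x)
      (𝓝[>] 0) (𝓝 0))
    (hf : Tendsto (fun x => gammaWeight lam r x * iteratedDeriv 1 f x) (𝓝[>] 0) (𝓝 0)) {j : ℕ}
    (hj : j ≤ n + 1) :
    Tendsto (fun x => gammaWeight lam (r + j) x * (j * iteratedDeriv j f x)) (𝓝[>] 0) (𝓝 0) ∧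
    Tendsto (fun x => gammaWeight lam (r + j) x * iteratedDeriv (j + 1) f x) (𝓝[>] 0) (𝓝 0) := by
  have hid : Tendsto (fun x : ℝ => x) (𝓝[>] 0) (𝓝 0) := tendsto_id.mono_left nhdsWithin_le_nhds
  -- Solving for f^(j+2) divides by x, which the extra power of x in W_(r+j+1) absorbs.
  induction j with
  | zero => exact ⟨by simp, by simpa using hf⟩
  | succ j ih =>
    have ih := ih (by omega)
    constructor
    · have h1 := (hid.mul ih.2).const_mul ((j : ℝ) + 1)
      simp only [mul_zero] at h1
      refine h1.congr' ?_
      filter_upwards [self_mem_nhdsWithin] with x hx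
      push_cast
      rw [← add_assoc, gammaWeight_add_one _ _ hx]
      ring
    · have h1 := ((hg j (by omega)).add (ih.1.const_mul lam)).sub
        (((hid.const_mul lam).const_sub (r + j)).mul ih.2)
      simp only [mul_zero, add_zero, sub_zero] at h1
      refine h1.congr' ?_
      filter_upwards [self_mem_nhdsWithin] with x hx
      have := hrec j (by omega) x hx
      push_cast
      rw [← add_assoc, gammaWeight_add_one _ _ hx]
      linear_combination (-gammaWeight lam (r + j) x) * this

/-! ### The bound on the top derivative. -/

/-- The bounds on the solution of the Stein equation `x f'' + (r - lam x) f' = g`. -/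
theorem gammaStein_bound {n : ℕ} {r lam : ℝ} {f g : ℝ → ℝ} (hr : 0 < r) (hlam : 0 < lam)
    (hg : ContDiffOn ℝ n g (Ioi 0)) (hf : ContDiffOn ℝ (n + 2 : ℕ) f (Ioi 0))
    (heq : ∀ x > 0, x * iteratedDeriv 2 f x + (r - lam * x) * iteratedDeriv 1 f x = g x)
    (hgAC : ∀ u v : ℝ, 0 < u → u ≤ v → AbsolutelyContinuousOnInterval (iteratedDeriv n g) u v)
    (hgtop : ∀ j ≤ n, ∀ s,
      Tendsto (fun x => gammaWeight lam s x * iteratedDeriv j g x) atTop (𝓝 0))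
    (hgzero : ∀ j ≤ n, Tendsto (fun x => gammaWeight lam (r + j) x * iteratedDeriv j g x)
      (𝓝[>] 0) (𝓝 0))
    (hftop : ∀ s, Tendsto (fun x => gammaWeight lam s x * iteratedDeriv 1 f x) atTop (𝓝 0))
    (hfzero : Tendsto (fun x => gammaWeight lam r x * iteratedDeriv 1 f x) (𝓝[>] 0) (𝓝 0))
    {H K : ℝ} (hH : ∀ᵐ x, 0 < x → |iteratedDeriv (n + 1) g x| ≤ H)
    (hK : ∀ x > 0, |iteratedDeriv n g x| ≤ K) (hK0 : n ≠ 0 → ∀ x > 0, |iteratedDeriv n g x| ≤ K / 2)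
    {x : ℝ} (hx : 0 < x) :
    (r + n + 1) * |iteratedDeriv (n + 2) f x| ≤ 2 * H + 2 * lam * K := by
  have hrec : ∀ j ≤ n, ∀ x > 0, x * iteratedDeriv (j + 2) f x +
      (r + j - lam * x) * iteratedDeriv (j + 1) f x =
      iteratedDeriv j g x + lam * (j * iteratedDeriv j f x) :=
    fun j hj x hx => iteratedDeriv_gammaStein_eq hg hf heq hj hx
  have hD : ∀ m < n + 2, ∀ x > 0, HasDerivAt (iteratedDeriv m f) (iteratedDeriv (m + 1) f x) x :=
    fun m hm x hx => hf.hasDerivAt_iteratedDeriv (by exact_mod_cast hm) hx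
  have hC : ∀ m ≤ n + 2, ContinuousOn (iteratedDeriv m f) (Ioi 0) :=
    fun m hm => hf.continuousOn_iteratedDeriv (by exact_mod_cast hm)
  set N : ℕ → ℝ → ℝ := fun j x => gammaWeight lam (r + j) x * iteratedDeriv (j + 1) f x with hNdef
  have hN0 : ∀ j ≤ n + 1, Tendsto (N j) (𝓝[>] 0) (𝓝 0) := fun j hj =>
    (tendsto_gammaWeight_mul_iteratedDeriv_zero hrec hgzero hfzero hj).2
  have hNtop : ∀ j ≤ n + 1, Tendsto (N j) atTop (𝓝 0) := fun j hj =>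
    (tendsto_gammaWeight_mul_iteratedDeriv_atTop hrec hgtop hftop hj _).2
  have hrj : ∀ j : ℕ, 0 < r + j := fun j => by positivity
  have hND : ∀ x > 0, HasDerivAt (N n) (gammaWeight lam (r + n - 1) x *
      (iteratedDeriv n g x + lam * n * iteratedDeriv n f x)) x := by
    intro x hx
    refine ((hasDerivAt_gammaWeight lam (r + n) hx).mul (hD (n + 1) (by omega) x hx)).congr_deriv ?_
    have hw := gammaWeight_add_one lam (r + n - 1) hx
    rw [sub_add_cancel] at hw
    rw [hw]
    linear_combination (gammaWeight lam (r + n - 1) x) * hrec n le_rfl x hx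
  have hNAC : ∀ u v : ℝ, 0 < u → u ≤ v → AbsolutelyContinuousOnInterval (N n) u v := by
    intro u v hu huv
    refine absolutelyContinuousOnInterval_of_hasDerivAt hND ?_ hu huv
    exact ((contDiffOn_gammaWeight lam _ 0).continuousOn).mul
      ((hg.continuousOn_iteratedDeriv le_rfl).add ((hC n (by omega)).const_smul (lam * (n : ℝ))))
  -- This is N_(n+1) with x f^(n+2) eliminated by the Stein equation. Every factor is now absolutely
  -- continuous, including g^(n), which need not be differentiable everywhere.
  set R : ℝ → ℝ := fun x => gammaWeight lam (r + n) x * (iteratedDeriv n g x +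
    (lam * n * iteratedDeriv n f x - (r + n - lam * x) * iteratedDeriv (n + 1) f x)) with hRdef
  have hNR : ∀ x > 0, N (n + 1) x = R x := by
    intro x hx
    simp only [hNdef, hRdef]
    push_cast
    rw [← add_assoc, gammaWeight_add_one _ _ hx]
    linear_combination (gammaWeight lam (r + n) x) * hrec n le_rfl x hx
  have hRAC : ∀ u v : ℝ, 0 < u → u ≤ v → AbsolutelyContinuousOnInterval R u v := by
    intro u v hu huv
    have hW : AbsolutelyContinuousOnInterval (gammaWeight lam (r + n)) u v :=
      ((contDiffOn_gammaWeight lam _ 1).mono (by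
        rw [uIcc_of_le huv]; exact fun t ht => hu.trans_le ht.1)).absolutelyContinuousOnInterval
    have hA : AbsolutelyContinuousOnInterval (iteratedDeriv n f) u v :=
      absolutelyContinuousOnInterval_of_hasDerivAt (hD n (by omega)) (hC _ (by omega)) hu huv
    have hB : AbsolutelyContinuousOnInterval (iteratedDeriv (n + 1) f) u v :=
      absolutelyContinuousOnInterval_of_hasDerivAt (hD (n + 1) (by omega)) (hC _ (by omega)) hu huv
    have hl : AbsolutelyContinuousOnInterval (fun x : ℝ => r + n - lam * x) u v :=
      ContDiffOn.absolutelyContinuousOnInterval (by fun_prop)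
    exact hW.mul ((hgAC u v hu huv).add ((hA.const_mul (lam * n)).sub (hl.mul hB)))
  -- The half-line is exhausted by the countably many compact intervals [1/(m+1), m+1].
  have hgdiff : ∀ᵐ x, 0 < x → DifferentiableAt ℝ (iteratedDeriv n g) x := by
    have h1 : ∀ m : ℕ, ∀ᵐ x, x ∈ uIcc (1 / ((m : ℝ) + 1)) (m + 1) →
        DifferentiableAt ℝ (iteratedDeriv n g) x := by
      intro m
      have hm : (1 : ℝ) ≤ (m : ℝ) + 1 := by linarith [Nat.cast_nonneg (α := ℝ) m]
      refine (hgAC _ _ (by positivity) ?_).ae_differentiableAt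
      exact ((div_le_one (by positivity)).2 hm).trans hm
    filter_upwards [ae_all_iff.2 h1] with x hx hpos
    obtain ⟨m1, hm1⟩ := exists_nat_one_div_lt hpos
    obtain ⟨m2, hm2⟩ := exists_nat_gt x
    refine hx (max m1 m2) (mem_uIcc_of_le (le_trans ?_ hm1.le) ?_)
    · gcongr; exact le_max_left _ _
    · have : (m2 : ℝ) ≤ (max m1 m2 : ℕ) := by exact_mod_cast le_max_right _ _
      linarith
  have hRD : ∀ᵐ x, 0 < x → HasDerivAt R (gammaWeight lam (r + (n + 1 : ℕ) - 1) x *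
      (iteratedDeriv (n + 1) g x + lam * (n + 1 : ℕ) * iteratedDeriv (n + 1) f x)) x := by
    filter_upwards [hgdiff] with x hd hx
    have hgd : HasDerivAt (iteratedDeriv n g) (iteratedDeriv (n + 1) g x) x := by
      rw [iteratedDeriv_succ]; exact (hd hx).hasDerivAt
    refine ((hasDerivAt_gammaWeight lam (r + n) hx).mul (hgd.add
      (((hD n (by omega) x hx).const_mul (lam * n)).sub
        ((((hasDerivAt_id x).const_mul lam).const_sub (r + n)).mul
          (hD (n + 1) (by omega) x hx))))).congr_deriv ?_
    have hw := gammaWeight_add_one lam (r + n - 1) hx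
    rw [sub_add_cancel] at hw
    rw [show r + ((n + 1 : ℕ) : ℝ) - 1 = r + n by push_cast; ring, hw]
    simp only [Pi.add_apply, Pi.sub_apply, Pi.mul_apply, id]
    push_cast
    linear_combination (-(r + n - lam * x) * gammaWeight lam (r + n - 1) x) * hrec n le_rfl x hx
  have hR0 : Tendsto R (𝓝[>] 0) (𝓝 0) := (hN0 (n + 1) le_rfl).congr' (by
    filter_upwards [self_mem_nhdsWithin] with x hx using hNR x hx)
  have hRtop : Tendsto R atTop (𝓝 0) := (hNtop (n + 1) le_rfl).congr' (by
    filter_upwards [eventually_gt_atTop 0] with x hx using hNR x hx)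
  -- For n = 0 the term in f is absent and K bounds g directly. For n > 0 the bound on g^(n) and the
  -- maximum principle each contribute K / 2.
  have hφn : ∀ x > 0, |iteratedDeriv n g x + lam * n * iteratedDeriv n f x| ≤ K := by
    intro x hx
    rcases Nat.eq_zero_or_pos n with rfl | hn
    · simpa using hK x hx
    · have h1 := mul_abs_le_of_maximum_principle (κ := lam * n) (v := iteratedDeriv n f)
        (v' := iteratedDeriv (n + 1) f) (p := gammaWeight lam (r + n))
        (w := gammaWeight lam (r + n - 1)) (N := N n) (ψ := iteratedDeriv n g) (by positivity)
        (fun _ h => gammaWeight_pos _ _ h) (fun _ h => gammaWeight_pos _ _ h)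
        (hD n (by omega)) (fun _ _ => rfl) hNAC (ae_of_all _ hND) (ae_of_all _ (hK0 hn.ne'))
        (hN0 n (by omega)) (hNtop n (by omega)) hx
      have h2 := abs_add_le (iteratedDeriv n g x) (lam * n * iteratedDeriv n f x)
      rw [abs_mul, abs_of_nonneg (show (0 : ℝ) ≤ lam * n by positivity)] at h2
      linarith [hK0 hn.ne' x hx]
  have hv : ∀ x > 0, lam * (n + 1 : ℕ) * |iteratedDeriv (n + 1) f x| ≤ H := fun x hx =>
    mul_abs_le_of_maximum_principle (v' := iteratedDeriv (n + 2) f)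
      (p := gammaWeight lam (r + (n + 1 : ℕ)))
      (w := gammaWeight lam (r + (n + 1 : ℕ) - 1)) (N := R) (ψ := iteratedDeriv (n + 1) g)
      (by positivity)
      (fun _ h => gammaWeight_pos _ _ h) (fun _ h => gammaWeight_pos _ _ h)
      (hD (n + 1) (by omega)) (fun t ht => (hNR t ht).symm) hRAC hRD hH hR0 hRtop hx
  have hφ : ∀ᵐ x, 0 < x →
      |iteratedDeriv (n + 1) g x + lam * (n + 1 : ℕ) * iteratedDeriv (n + 1) f x| ≤ 2 * H := by
    filter_upwards [hH] with x h1 hx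
    have h2 := abs_add_le (iteratedDeriv (n + 1) g x) (lam * (n + 1 : ℕ) * iteratedDeriv (n + 1) f x)
    rw [abs_mul (lam * _), abs_of_nonneg (show (0 : ℝ) ≤ lam * (n + 1 : ℕ) by positivity)] at h2
    linarith [h1 hx, hv x hx]
  have hHnn : 0 ≤ H := le_trans (by positivity) (hv x hx)
  have hKnn : 0 ≤ K := (abs_nonneg _).trans (hK x hx)
  have e1 := abs_mul_abs_le_gammaWeight hlam (hrj n) hKnn hNAC (ae_of_all _ hND)
    (ae_of_all _ hφn) (hN0 n (by omega)) (hNtop n (by omega)) hx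
  have e2 := abs_mul_abs_le_gammaWeight hlam (hrj (n + 1)) (by positivity) hRAC hRD hφ hR0 hRtop hx
  rw [← hNR x hx] at e2
  simp only [hNdef] at e1 e2
  rw [abs_mul, abs_of_pos (gammaWeight_pos lam _ hx), mul_left_comm, mul_comm K] at e1
  rw [abs_mul, abs_of_pos (gammaWeight_pos lam _ hx), mul_left_comm, mul_comm (2 * H)] at e2
  have e1 := le_of_mul_le_mul_left e1 (gammaWeight_pos lam _ hx)
  have e2 := le_of_mul_le_mul_left e2 (gammaWeight_pos lam _ hx)
  have e3 : x * |iteratedDeriv (n + 2) f x| ≤ 2 * K := by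
    have h1 : x * iteratedDeriv (n + 2) f x =
        (iteratedDeriv n g x + lam * n * iteratedDeriv n f x) -
          (r + n - lam * x) * iteratedDeriv (n + 1) f x := by
      linarith [hrec n le_rfl x hx]
    have h2 := abs_sub (iteratedDeriv n g x + lam * n * iteratedDeriv n f x)
      ((r + n - lam * x) * iteratedDeriv (n + 1) f x)
    rw [← h1, abs_mul, abs_mul, abs_of_pos hx] at h2
    linarith [hφn x hx]
  have e4 := mul_le_mul_of_nonneg_left e3 hlam.le
  have e5 := mul_le_mul_of_nonneg_right (le_abs_self (r + (n + 1 : ℕ) - lam * x))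
    (abs_nonneg (iteratedDeriv (n + 2) f x))
  push_cast at e2 e5
  -- The first summand is at most 2 H by `e2`, the second at most 2 lam K by `e3`.
  have e6 : (r + n + 1) * |iteratedDeriv (n + 2) f x| =
    (r + (n + 1) - lam * x) * |iteratedDeriv (n + 2) f x| +
      lam * (x * |iteratedDeriv (n + 2) f x|) := by ring
  rw [e6]
  have e7 : |r + (n + 1) - lam * x| * |iteratedDeriv (n + 2) f x| ≤ 2 * H := e2
  linarith

/-! ### Integrability and decay under exponential growth. -/

theorem integral_gammaWeight {lam s : ℝ} (hlam : 0 < lam) (hs : 0 < s) :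
    ∫ t in Ioi (0 : ℝ), gammaWeight lam (s - 1) t = (1 / lam) ^ s * Real.Gamma s :=
  Real.integral_rpow_mul_exp_neg_mul_Ioi hs hlam

theorem integrableOn_gammaWeight {lam s : ℝ} (hlam : 0 < lam) (hs : 0 < s) :
    IntegrableOn (gammaWeight lam (s - 1)) (Ioi 0) := by
  -- A non-integrable function has integral 0 by convention, so a positive value forces
  -- integrability.
  refine .of_integral_ne_zero ?_
  rw [integral_gammaWeight hlam hs]
  have := Real.Gamma_pos_of_pos hs
  positivity

/-- Growth of order e^(b x) only lowers the rate of the weight from lam to lam - b, which stays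
positive when b < lam. -/
theorem abs_gammaWeight_mul_le {lam b c s : ℝ} {u : ℝ → ℝ}
    (hu : ∀ x > 0, |u x| ≤ c * Real.exp (b * x)) {x : ℝ} (hx : 0 < x) :
    |gammaWeight lam s x * u x| ≤ c * gammaWeight (lam - b) s x := by
  rw [abs_mul, abs_of_pos (gammaWeight_pos _ _ hx)]
  calc gammaWeight lam s x * |u x| ≤ gammaWeight lam s x * (c * Real.exp (b * x)) :=
        mul_le_mul_of_nonneg_left (hu x hx) (gammaWeight_pos _ _ hx).le
    _ = c * gammaWeight (lam - b) s x := by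
        unfold gammaWeight
        rw [show -((lam - b) * x) = -(lam * x) + b * x by ring, Real.exp_add]
        ring

theorem tendsto_gammaWeight_mul_atTop {lam b c : ℝ} {u : ℝ → ℝ} (hb : b < lam)
    (hu : ∀ x > 0, |u x| ≤ c * Real.exp (b * x)) (s : ℝ) :
    Tendsto (fun x => gammaWeight lam s x * u x) atTop (𝓝 0) := by
  refine squeeze_zero_norm' (a := fun x => c * gammaWeight (lam - b) s x) ?_ ?_
  · filter_upwards [eventually_gt_atTop 0] with x hx using abs_gammaWeight_mul_le hu hx
  · simpa using (tendsto_gammaWeight_atTop (sub_pos.2 hb) s).const_mul c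

theorem tendsto_gammaWeight_mul_zero {lam b c s : ℝ} {u : ℝ → ℝ} (hs : 0 < s)
    (hu : ∀ x > 0, |u x| ≤ c * Real.exp (b * x)) :
    Tendsto (fun x => gammaWeight lam s x * u x) (𝓝[>] 0) (𝓝 0) := by
  refine squeeze_zero_norm' (a := fun x => c * gammaWeight (lam - b) s x) ?_ ?_
  · filter_upwards [self_mem_nhdsWithin] with x hx using abs_gammaWeight_mul_le hu hx
  · simpa using (tendsto_gammaWeight_zero (lam - b) hs).const_mul c

theorem integrableOn_gammaWeight_mul {lam b c s : ℝ} {u : ℝ → ℝ} (hb : b < lam) (hs : 0 < s)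
    (huc : ContinuousOn u (Ioi 0)) (hu : ∀ x > 0, |u x| ≤ c * Real.exp (b * x)) :
    IntegrableOn (fun x => gammaWeight lam (s - 1) x * u x) (Ioi 0) := by
  refine ((integrableOn_gammaWeight (sub_pos.2 hb) hs).const_mul c).mono' ?_ ?_
  · exact (((contDiffOn_gammaWeight lam _ 0).continuousOn).mul huc).aestronglyMeasurable
      measurableSet_Ioi
  · exact (ae_restrict_iff' measurableSet_Ioi).2
      (ae_of_all _ fun x hx => abs_gammaWeight_mul_le hu hx)

/-- If `F` has integral zero over `(0, ∞)` and all moments of `F` are finite, then its primitive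
decays faster than every power. -/
theorem tendsto_rpow_mul_primitive_atTop {F : ℝ → ℝ} (hF : IntegrableOn F (Ioi 0))
    (hF0 : ∫ t in Ioi (0 : ℝ), F t = 0)
    (hm : ∀ s : ℝ, 0 ≤ s → IntegrableOn (fun t => t ^ s * F t) (Ioi 0)) (s : ℝ) :
    Tendsto (fun x : ℝ => x ^ s * ∫ t in (0 : ℝ)..x, F t) atTop (𝓝 0) := by
  set m := max s 0
  have hI : IntegrableOn (fun t => ‖t ^ m * F t‖) (Ioi 0) := (hm m (le_max_right _ _)).norm
  have hlim : Tendsto (fun x : ℝ => ∫ t in Ioi x, ‖t ^ m * F t‖) atTop (𝓝 0) := by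
    have h1 := (intervalIntegral_tendsto_integral_Ioi 0 hI tendsto_id).const_sub
      (∫ t in Ioi (0 : ℝ), ‖t ^ m * F t‖)
    rw [sub_self] at h1
    refine h1.congr' ?_
    filter_upwards [eventually_gt_atTop 0] with x hx
    rw [← intervalIntegral.integral_interval_add_Ioi hI (hI.mono_set (Ioi_subset_Ioi hx.le))]
    simp
  refine squeeze_zero_norm' ?_ hlim
  filter_upwards [eventually_ge_atTop 1] with x hx
  have hx0 : 0 < x := by linarith
  have hsub : Ioi x ⊆ Ioi (0 : ℝ) := Ioi_subset_Ioi hx0.le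
  have h2 := intervalIntegral.integral_interval_add_Ioi hF (hF.mono_set hsub)
  rw [hF0] at h2
  -- Mean zero turns the primitive into minus a tail integral, where x^s ≤ t^m for t > x ≥ 1.
  have h3 : x ^ s * ∫ t in (0 : ℝ)..x, F t = -(∫ t in Ioi x, x ^ s * F t) := by
    rw [integral_const_mul]
    linear_combination (x ^ s) * h2
  rw [h3, norm_neg]
  refine (norm_integral_le_integral_norm _).trans ?_
  refine setIntegral_mono_on ((hF.mono_set hsub).const_mul _).norm (hI.mono_set hsub)
    measurableSet_Ioi fun t ht => ?_
  have ht0 : 0 < t := hx0.trans ht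
  rw [norm_mul, norm_mul, Real.norm_of_nonneg (Real.rpow_nonneg hx0.le s),
    Real.norm_of_nonneg (Real.rpow_nonneg ht0.le m)]
  refine mul_le_mul_of_nonneg_right ?_ (norm_nonneg _)
  calc x ^ s ≤ x ^ m := Real.rpow_le_rpow_of_exponent_le hx (le_max_left _ _)
    _ ≤ t ^ m := Real.rpow_le_rpow hx0.le (le_of_lt ht) (le_max_right _ _)

/-! ### From the integral formula to the Stein factor bound. -/

/-- The Stein factor bound for a centred right-hand side, in terms of the gamma weight. -/
theorem gammaStein_solution {n : ℕ} {r lam μ : ℝ} {f h : ℝ → ℝ} (hr : 0 < r) (hlam : 0 < lam)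
    (hh : h ∈ testClass lam (n + 1))
    (hμ : ∫ t in Ioi (0 : ℝ), gammaWeight lam (r - 1) t * (h t - μ) = 0)
    (hf : ∀ x > 0, HasDerivAt f
      (1 / gammaWeight lam r x * ∫ t in (0 : ℝ)..x, gammaWeight lam (r - 1) t * (h t - μ)) x) :
    ContDiffOn ℝ (n + 2 : ℕ) f (Ioi 0) ∧
    (∀ x > 0, x * iteratedDeriv 2 f x + (r - lam * x) * deriv f x = h x - μ) ∧
    ∀ H K : ℝ, (∀ᵐ x, 0 < x → |iteratedDeriv (n + 1) h x| ≤ H) →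
      (∀ x > 0, |iteratedDeriv n h x| ≤ K) → (n = 0 → |μ| ≤ K) →
      ∀ x > 0, (r + n + 1) * |iteratedDeriv (n + 2) f x| ≤ 2 * H + 2 * lam * (2 * K) := by
  obtain ⟨hhC, ⟨c, hc, a, ha, hgrow⟩, hAC⟩ := hh
  rw [Nat.add_sub_cancel] at hhC hAC
  set g : ℝ → ℝ := fun x => h x - μ with hgdef
  -- Nonnegativity of b gives e^(b x) ≥ 1, so the constant μ obeys the same growth bound as h.
  set b := max a 0
  have hb : b < lam := max_lt ha hlam
  have hder : ∀ j, j ≠ 0 → iteratedDeriv j g = iteratedDeriv j h := by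
    intro j hj
    obtain ⟨j, rfl⟩ := Nat.exists_eq_succ_of_ne_zero hj
    rw [Nat.succ_eq_add_one, iteratedDeriv_succ', iteratedDeriv_succ']
    congr 1
    ext x
    simp [hgdef, deriv_sub_const]
  have hg : ContDiffOn ℝ n g (Ioi 0) := hhC.sub contDiffOn_const
  have hgb : ∀ j ≤ n, ∀ x > 0, |iteratedDeriv j g x| ≤ (c + |μ|) * Real.exp (b * x) := by
    intro j hj x hx
    have h1 : |iteratedDeriv j h x| ≤ c * Real.exp (b * x) := by
      refine (hgrow x hx j (by omega)).trans ?_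
      gcongr
      exact le_max_left _ _
    have h2 : |μ| ≤ |μ| * Real.exp (b * x) :=
      le_mul_of_one_le_right (abs_nonneg _) (Real.one_le_exp (mul_nonneg (le_max_right _ _) hx.le))
    rw [add_mul]
    rcases eq_or_ne j 0 with rfl | hj0
    · simp only [iteratedDeriv_zero] at h1 ⊢
      exact (abs_sub _ _).trans (by linarith)
    · rw [hder j hj0]
      linarith [abs_nonneg μ]
  have hgAC : ∀ u v : ℝ, 0 < u → u ≤ v → AbsolutelyContinuousOnInterval (iteratedDeriv n g) u v := by
    intro u v hu huv
    rcases eq_or_ne n 0 with rfl | hn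
    · have := hAC u v hu huv
      simp only [iteratedDeriv_zero] at this ⊢
      exact this.sub (ContDiffOn.absolutelyContinuousOnInterval contDiffOn_const)
    · rw [hder n hn]
      exact hAC u v hu huv
  have hgc : ContinuousOn g (Ioi 0) := hg.continuousOn
  have hgb0 : ∀ x > 0, |g x| ≤ (c + |μ|) * Real.exp (b * x) := by
    simpa using hgb 0 (Nat.zero_le _)
  set F : ℝ → ℝ := fun t => gammaWeight lam (r - 1) t * g t with hFdef
  have hF : IntegrableOn F (Ioi 0) := integrableOn_gammaWeight_mul hb hr hgc hgb0
  have hFm : ∀ s : ℝ, 0 ≤ s → IntegrableOn (fun t => t ^ s * F t) (Ioi 0) := by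
    intro s hs
    refine (integrableOn_gammaWeight_mul (s := s + r) hb (by linarith) hgc hgb0).congr_fun
      (fun t ht => ?_) measurableSet_Ioi
    simp only [hFdef, gammaWeight]
    rw [show s + r - 1 = s + (r - 1) by ring, Real.rpow_add ht]
    ring
  have hfI : ∀ x > 0, gammaWeight lam r x * deriv f x = ∫ t in (0 : ℝ)..x, F t := by
    intro x hx
    have := (gammaWeight_pos lam r hx).ne'
    rw [(hf x hx).deriv]
    field_simp
  have hI : ∀ x > 0, HasDerivAt (fun x : ℝ => ∫ t in (0 : ℝ)..x, F t) (F x) x := by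
    intro x hx
    have hFc : ContinuousOn F (Ioi 0) := ((contDiffOn_gammaWeight lam _ 0).continuousOn).mul hgc
    refine intervalIntegral.integral_hasDerivAt_right ?_ ?_ (hFc.continuousAt (Ioi_mem_nhds hx))
    · exact (intervalIntegrable_iff_integrableOn_Ioc_of_le hx.le).2
        (hF.mono_set Ioc_subset_Ioi_self)
    · exact hFc.stronglyMeasurableAtFilter isOpen_Ioi x hx
  have hf' : ∀ x > 0, HasDerivAt (deriv f) ((g x - (r - lam * x) * deriv f x) / x) x := by
    intro x hx
    have hW := (gammaWeight_pos lam r hx).ne'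
    have h1 := ((hI x hx).div (hasDerivAt_gammaWeight lam r hx) hW)
    have h2 := h1.congr_of_eventuallyEq (f₁ := deriv f) (by
      filter_upwards [Ioi_mem_nhds hx] with y hy
      have := (gammaWeight_pos lam r hy).ne'
      rw [Pi.div_apply, ← hfI y hy]
      field_simp)
    refine h2.congr_deriv ?_
    rw [← hfI x hx]
    have hw := gammaWeight_add_one lam (r - 1) hx
    rw [sub_add_cancel] at hw
    have hW' := (gammaWeight_pos lam (r - 1) hx).ne'
    simp only [hFdef]
    rw [hw]
    field_simp
  have hfC := contDiffOn_of_gammaStein_eq hg (fun x hx => (hf x hx).differentiableAt) hf'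
  have heq : ∀ x > 0, x * iteratedDeriv 2 f x + (r - lam * x) * iteratedDeriv 1 f x = g x := by
    intro x hx
    rw [iteratedDeriv_succ, iteratedDeriv_one, (hf' x hx).deriv]
    field_simp
    ring
  refine ⟨hfC, fun x hx => by simpa [iteratedDeriv_one] using heq x hx, ?_⟩
  intro H K hH hK hμK x hx
  -- The centring constant survives only for n = 0, where it doubles the bound.
  have hgK : ∀ x > 0, |iteratedDeriv n g x| ≤ 2 * K := by
    intro x hx
    rcases eq_or_ne n 0 with rfl | hn
    · have h1 := hK x hx
      have h2 := hμK rfl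
      simp only [iteratedDeriv_zero] at h1 ⊢
      exact (abs_sub _ _).trans (by linarith)
    · rw [hder n hn]
      linarith [hK x hx, abs_nonneg (iteratedDeriv n h x)]
  refine gammaStein_bound hr hlam hg hfC heq hgAC
    (fun j hj s => tendsto_gammaWeight_mul_atTop hb (hgb j hj) s)
    (fun j hj => tendsto_gammaWeight_mul_zero (by positivity) (hgb j hj)) ?_ ?_ ?_ hgK ?_ hx
  · intro s
    -- W_s f' equals x^(s-r) times the primitive of F.
    refine (tendsto_rpow_mul_primitive_atTop hF hμ hFm (s - r)).congr' ?_
    filter_upwards [eventually_gt_atTop 0] with x hx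
    rw [← hfI x hx, iteratedDeriv_one, ← mul_assoc]
    unfold gammaWeight
    rw [← mul_assoc, ← Real.rpow_add hx, sub_add_cancel]
  · have h1 : ContinuousOn (fun x : ℝ => ∫ t in (0 : ℝ)..x, F t) (uIcc 0 1) := by
      refine intervalIntegral.continuousOn_primitive_interval ?_
      rw [uIcc_of_le zero_le_one, integrableOn_Icc_iff_integrableOn_Ioc]
      exact hF.mono_set Ioc_subset_Ioi_self
    have h2 := (h1 0 left_mem_uIcc).tendsto
    rw [intervalIntegral.integral_same, uIcc_of_le zero_le_one] at h2
    have h3 : 𝓝[>] (0 : ℝ) ≤ 𝓝[Icc 0 1] 0 :=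
      nhdsWithin_le_of_mem (mem_of_superset (Ioc_mem_nhdsGT one_pos) Ioc_subset_Icc_self)
    refine (h2.mono_left h3).congr' ?_
    filter_upwards [self_mem_nhdsWithin] with x hx
    rw [← hfI x hx, iteratedDeriv_one]
  · simpa [hder (n + 1) (by omega)] using hH
  · intro hn x hx
    rw [hder n hn]
    linarith [hK x hx]

theorem enorm_le_supNormPos (g : ℝ → ℝ) {x : ℝ} (hx : 0 < x) : ‖g x‖ₑ ≤ supNormPos g :=
  le_iSup₂ (f := fun x (_ : x ∈ Ioi (0 : ℝ)) => ‖g x‖ₑ) x hx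

/-- The Stein factor bound for a density proportional to the gamma weight. -/
theorem steinDeriv_solution {n : ℕ} {r lam C : ℝ} {f h q : ℝ → ℝ} (hr : 0 < r) (hlam : 0 < lam)
    (hC : C = lam ^ r / Real.Gamma r) (hqm : Measurable q)
    (hq : ∀ x > 0, q x = C * gammaWeight lam (r - 1) x) (hq0 : ∀ x < 0, q x = 0)
    (hh : h ∈ testClass lam (n + 1)) (hb : ∃ M : ℝ, ∀ x > (0 : ℝ), |iteratedDeriv n h x| ≤ M)
    {μ : ℝ} (hμ : μ = ∫ x, h x ∂(volume.withDensity fun x => ENNReal.ofReal (q x)))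
    (hf : ∀ x > (0 : ℝ), HasDerivAt f (steinDeriv q μ h x) x) :
    ContDiffOn ℝ (n + 2 : ℕ) f (Ioi 0) ∧
    (∀ x > 0, x * iteratedDeriv 2 f x + (r - lam * x) * deriv f x = h x - μ) ∧
    supNormPos (iteratedDeriv (n + 2) f) ≤ ENNReal.ofReal (2 / (r + n + 1)) *
      (3 * essSupNormPos (iteratedDeriv (n + 1) h) +
        2 * ENNReal.ofReal lam * supNormPos (iteratedDeriv n h)) := by
  have hΓ := Real.Gamma_pos_of_pos hr
  have hCpos : 0 < C := by rw [hC]; positivity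
  have hCW : C * ∫ t in Ioi (0 : ℝ), gammaWeight lam (r - 1) t = 1 := by
    rw [integral_gammaWeight hlam hr, hC, Real.div_rpow zero_le_one hlam.le, Real.one_rpow]
    field_simp
  have hμ' : μ = C * ∫ t in Ioi (0 : ℝ), gammaWeight lam (r - 1) t * h t := by
    rw [hμ, integral_withDensity_eq_integral_toReal_smul (by fun_prop)
      (ae_of_all _ fun _ => ENNReal.ofReal_lt_top), ← integral_const_mul]
    -- The value of q at 0 is unspecified, so the support is first cut to [0, ∞) and the null point
    -- is then dropped.
    rw [← integral_Ici_eq_integral_Ioi]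
    rw [← setIntegral_eq_integral_of_forall_compl_eq_zero (s := Ici (0 : ℝ))]
    · rw [integral_Ici_eq_integral_Ioi, integral_Ici_eq_integral_Ioi]
      refine setIntegral_congr_fun measurableSet_Ioi fun x hx => ?_
      have hqx := hq x hx
      have : 0 ≤ q x := by
        rw [hqx]; exact (mul_pos hCpos (gammaWeight_pos _ _ hx)).le
      simp only [smul_eq_mul]
      rw [ENNReal.toReal_ofReal this, hqx]
      ring
    · intro x hx
      simp [hq0 x (not_le.1 hx)]
  obtain ⟨hhC, ⟨c, hc, a, ha, hgrow⟩, hAC⟩ := id hh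
  have hInt : IntegrableOn (fun x => gammaWeight lam (r - 1) x * h x) (Ioi 0) :=
    integrableOn_gammaWeight_mul ha hr hhC.continuousOn fun x hx => by
      simpa using hgrow x hx 0 (Nat.succ_pos n)
  have hμ0 : ∫ t in Ioi (0 : ℝ), gammaWeight lam (r - 1) t * (h t - μ) = 0 := by
    have h1 := integral_sub hInt ((integrableOn_gammaWeight hlam hr).mul_const μ)
    rw [integral_mul_const] at h1
    simp only [mul_sub]
    rw [h1]
    refine (mul_eq_zero.1 (?_ : C * _ = 0)).resolve_left hCpos.ne'
    linear_combination -hμ' - μ * hCW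
  have hf' : ∀ x > 0, HasDerivAt f
      (1 / gammaWeight lam r x * ∫ t in (0 : ℝ)..x, gammaWeight lam (r - 1) t * (h t - μ)) x := by
    intro x hx
    convert hf x hx using 1
    unfold steinDeriv
    have h1 : ∫ t in (0 : ℝ)..x, (h t - μ) * q t =
        C * ∫ t in (0 : ℝ)..x, gammaWeight lam (r - 1) t * (h t - μ) := by
      rw [← intervalIntegral.integral_const_mul]
      refine intervalIntegral.integral_congr_ae (ae_of_all _ fun t ht => ?_)
      rw [uIoc_of_le hx.le] at ht
      rw [hq t ht.1]
      ring
    have hw := gammaWeight_add_one lam (r - 1) hx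
    rw [sub_add_cancel] at hw
    have hW := (gammaWeight_pos lam (r - 1) hx).ne'
    rw [h1, hq x hx, hw]
    field_simp
  obtain ⟨h1, h2, h3⟩ := gammaStein_solution hr hlam hh hμ0 hf'
  refine ⟨h1, h2, ?_⟩
  have hden : 0 < r + n + 1 := by positivity
  set E := essSupNormPos (iteratedDeriv (n + 1) h) with hE
  set S := supNormPos (iteratedDeriv n h) with hS
  have hSfin : S ≠ ⊤ := by
    obtain ⟨M, hM⟩ := hb
    refine ne_top_of_le_ne_top (b := ENNReal.ofReal M) ENNReal.ofReal_ne_top ?_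
    refine iSup₂_le fun x hx => ?_
    rw [Real.enorm_eq_ofReal_abs]
    exact ENNReal.ofReal_le_ofReal (hM x hx)
  rcases eq_or_ne E ⊤ with hEt | hEt
  · have : ENNReal.ofReal (2 / (r + n + 1)) ≠ 0 := by
      rw [Ne, ENNReal.ofReal_eq_zero, not_le]; positivity
    rw [hEt, ENNReal.mul_top (by simp), top_add, ENNReal.mul_top this]
    exact le_top
  have hH : ∀ᵐ x, 0 < x → |iteratedDeriv (n + 1) h x| ≤ E.toReal := by
    refine (ae_restrict_iff' measurableSet_Ioi).1 ?_
    have := ae_le_essSup (f := fun x => ‖iteratedDeriv (n + 1) h x‖ₑ)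
      (μ := volume.restrict (Ioi (0 : ℝ)))
    filter_upwards [this] with x hx
    rw [← Real.norm_eq_abs, ← toReal_enorm]
    exact ENNReal.toReal_mono hEt hx
  have hK : ∀ x > 0, |iteratedDeriv n h x| ≤ S.toReal := by
    intro x hx
    rw [← Real.norm_eq_abs, ← toReal_enorm]
    exact ENNReal.toReal_mono hSfin (enorm_le_supNormPos _ hx)
  -- The density C W_(r-1) has total mass one, so the mean of h is at most its supremum.
  have hμK : n = 0 → |μ| ≤ S.toReal := by
    rintro rfl
    have hle : |∫ t in Ioi (0 : ℝ), gammaWeight lam (r - 1) t * h t| ≤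
        ∫ t in Ioi (0 : ℝ), gammaWeight lam (r - 1) t * S.toReal := by
      refine (norm_integral_le_integral_norm _).trans (setIntegral_mono_on hInt.norm
        ((integrableOn_gammaWeight hlam hr).mul_const _) measurableSet_Ioi fun t ht => ?_)
      rw [norm_mul, Real.norm_of_nonneg (gammaWeight_pos _ _ ht).le]
      exact mul_le_mul_of_nonneg_left (by simpa using hK t ht) (gammaWeight_pos _ _ ht).le
    rw [integral_mul_const] at hle
    rw [hμ', abs_mul, abs_of_pos hCpos]
    calc _ ≤ C * _ := mul_le_mul_of_nonneg_left hle hCpos.le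
      _ = S.toReal := by rw [← mul_assoc, hCW, one_mul]
  refine iSup₂_le fun x hx => ?_
  have h4 := h3 _ _ hH hK hμK x hx
  have hE0 : 0 ≤ E.toReal := ENNReal.toReal_nonneg
  have hS0 : 0 ≤ S.toReal := ENNReal.toReal_nonneg
  -- `h4` gives 2 E + 4 lam S in the numerator; the stated 6 E + 4 lam S is weaker.
  have h5 : |iteratedDeriv (n + 2) f x| ≤
      2 / (r + n + 1) * (3 * E.toReal + 2 * lam * S.toReal) := by
    rw [div_mul_eq_mul_div, le_div_iff₀ hden]
    linarith
  rw [Real.enorm_eq_ofReal_abs]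
  refine (ENNReal.ofReal_le_ofReal h5).trans_eq ?_
  rw [ENNReal.ofReal_mul (by positivity), ENNReal.ofReal_add (by positivity) (by positivity),
    ENNReal.ofReal_mul (by norm_num), ENNReal.ofReal_mul (by positivity),
    ENNReal.ofReal_mul (by norm_num), ENNReal.ofReal_toReal hEt, ENNReal.ofReal_toReal hSfin]
  simp

/-! ### The gamma and chi-square cases. -/

theorem measurable_chiSquarePDF (p : ℝ) : Measurable (chiSquarePDF p) := by
  unfold chiSquarePDF
  exact Measurable.ite measurableSet_Ioi (by fun_prop) measurable_const

end GammaStein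

theorem theorem2p2 (k : ℕ) (hk : 2 ≤ k) :
    (∀ r lam : ℝ, 0 < r → 0 < lam →
      ∀ h ∈ testClass lam (k - 1), (∃ M : ℝ, ∀ x > (0 : ℝ), |iteratedDeriv (k - 2) h x| ≤ M) →
      ∀ f : ℝ → ℝ, IsGammaSteinSolution r lam h f →
        ContDiffOn ℝ k f (Ioi 0) ∧
        (∀ x > (0 : ℝ), x * iteratedDeriv 2 f x + (r - lam * x) * deriv f x
          = h x - gammaMean r lam h) ∧
        supNormPos (iteratedDeriv k f) ≤
          ENNReal.ofReal (2 / (r + (k : ℝ) - 1)) *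
            (3 * essSupNormPos (iteratedDeriv (k - 1) h) +
              2 * ENNReal.ofReal lam * supNormPos (iteratedDeriv (k - 2) h))) ∧
    (∀ p : ℝ, 0 < p →
      ∀ h ∈ testClass (1 / 2) (k - 1),
      (∃ M : ℝ, ∀ x > (0 : ℝ), |iteratedDeriv (k - 2) h x| ≤ M) →
      ∀ f : ℝ → ℝ, IsChiSquareSteinSolution p h f →
        ContDiffOn ℝ k f (Ioi 0) ∧
        (∀ x > (0 : ℝ), x * iteratedDeriv 2 f x + 1 / 2 * (p - x) * deriv f x
          = h x - chiSquareMean p h) ∧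
        supNormPos (iteratedDeriv k f) ≤
          ENNReal.ofReal (4 / (p + 2)) *
            (3 * essSupNormPos (iteratedDeriv (k - 1) h) +
              supNormPos (iteratedDeriv (k - 2) h))) := by
  obtain ⟨n, rfl⟩ := Nat.exists_eq_add_of_le' hk
  rw [show n + 2 - 1 = n + 1 from rfl, Nat.add_sub_cancel]
  constructor
  · intro r lam hr hlam h hh hb f hf
    rw [show r + ((n + 2 : ℕ) : ℝ) - 1 = r + n + 1 by push_cast; ring]
    refine steinDeriv_solution hr hlam rfl (measurable_gammaPDFReal r lam) ?_ ?_ hh hb rfl hf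
    · intro x hx
      rw [gammaPDFReal, if_pos (le_of_lt hx), gammaWeight, mul_assoc]
    · intro x hx
      rw [gammaPDFReal, if_neg (not_le.2 hx)]
  · intro p hp h hh hb f hf
    have hq : ∀ x > 0, chiSquarePDF p x =
        (1 / 2) ^ (p / 2) / Real.Gamma (p / 2) * gammaWeight (1 / 2) (p / 2 - 1) x := by
      intro x hx
      have hΓ := Real.Gamma_pos_of_pos (half_pos hp)
      rw [chiSquarePDF, if_pos hx, gammaWeight, Real.div_rpow zero_le_one zero_le_two,
        Real.one_rpow, show -(1 / 2 * x) = -x / 2 by ring]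
      field_simp
    have hq0 : ∀ x < 0, chiSquarePDF p x = 0 := fun x hx => by
      rw [chiSquarePDF, if_neg (not_lt.2 hx.le)]
    obtain ⟨h1, h2, h3⟩ := steinDeriv_solution (half_pos hp) (by norm_num) rfl
      (measurable_chiSquarePDF p) hq hq0 hh hb rfl hf
    refine ⟨h1, fun x hx => ?_, h3.trans ?_⟩
    · have := h2 x hx
      change _ = h x - chiSquareMean p h at this
      rw [← this]
      ring
    · rw [show (2 : ℝ≥0∞) * ENNReal.ofReal (1 / 2) = 1 by
        rw [← ENNReal.ofReal_ofNat, ← ENNReal.ofReal_mul (by norm_num)]; norm_num, one_mul]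
      -- With r = p / 2 the gamma factor is 4 / (p + 2 n + 2), largest at n = 0.
      refine mul_le_mul_left (ENNReal.ofReal_le_ofReal ?_) _
      rw [div_le_div_iff₀ (by positivity) (by positivity)]
      have : (0 : ℝ) ≤ n := n.cast_nonneg
      linarith
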